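/- \textbf{Model.} An acyclic ADT network consists of a finite set $\mathcal V$ of supernodes, each supernode $V$ having finite disjoint sets $I(V)$ of input ports and $O(V)$ of output ports, and a set $\mathcal E$ of edges $(e,e')$ from output ports to input ports, such that the directed graph induced on $\mathcal V$ has no directed cycle. Fix a finite field $\mathbb F_q$, a source $S\in\mathcal V$, destinations $T_1,\dots,T_N\in\mathcal V\setminus\{S\}$, and source symbols $\mathcal X(S)=[X_1,\dots,X_R]$, where $R=|\mathcal X(S)|$. A coding assignment over a field $K\supseteq\mathbb F_q$ is a choice of elements $\alpha_{(k,e)}$ ($1\le k\le R$, $e\in O(S)$), $\beta_{(e',e)}$ ($e'\in I(V)$, $e\in O(V)$, $V\in\mathcal V$) and $\epsilon_{(e',(T_i,k))}$ ($e'\in I(T_i)$, $1\le k\le R$) of $K$. It determines the port symbols $Y$ by $Y(e')=\sum_{(e,e')\in\mathcal E}Y(e)$ at each input port $e'$ and $$Y(e)=\sum_{e'\in I(V)}\beta_{(e',e)}Y(e')+\begin{cases}\sum_{k}\alpha_{(k,e)}X_k,&V=S,\\0,&V\neq S,\end{cases}$$ at each $e\in O(V)$, and destination $T_i$ forms $Z(T_i,k)=\sum_{e'\in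 I(T_i)}\epsilon_{(e',(T_i,k))}Y(e')$. The multicast problem is \emph{solvable over $K$} if some coding assignment over $K$ gives $Z(T_i,k)=X_k$ for all $i$, all $k$ and all values of the source symbols in $K$. Let $F$ be the matrix indexed by the ports with $F_{e,e'}=1$ for $(e,e')\in\mathcal E$, $F_{e',e}=\beta_{(e',e)}$ for $e'\in I(V)$, $e\in O(V)$, and $0$ elsewhere. Let $A$ and $B_i$ be the matrices with $R$ rows and columns indexed by the ports that have entries $\alpha_{(k,e)}$ at $e\in O(S)$, respectively $\epsilon_{(e',(T_i,k))}$ at $e'\in I(T_i)$, and $0$ elsewhere. The $R\times R$ system matrices are $M_i=A(I-F)^{-1}B_i^{T}$. For $\Omega\subseteq\mathcal V$ let $G_\Omega$ be the $0$-$1$ matrix of the edges from output ports of supernodes in $\Omega$ to input ports of supernodes outside $\Omega$, and let $\mathrm{mincut}(S,T)=\min_{\Omega}\operatorname{rank}(G_\Omega)$, the minimum being over all $\Omega$ with $S\in\Omega$, $T\notin\Omega$, and the rank being taken over $\mathbb F_q$. \textbf{Theorem (Single Multicast Theorem).} \begin{enumerate} \item The multicast problem is solvable over some finite extension field of $\mathbb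 F_q$ if and only if $\mathrm{mincut}(S,T_i)\ge|\mathcal X(S)|$ for all $i$. \item For every $q$, if the problem is solvable over $\mathbb F_q$, then $\mathrm{mincut}(S,T_i)\ge|\mathcal X(S)|$ for all $i$. \item If $q>N$, then the problem is solvable over $\mathbb F_q$ itself if and only if $\mathrm{mincut}(S,T_i)\ge|\mathcal X(S)|$ for all $i$; and in that case there is one coding assignment over $\mathbb F_q$ with $\det(M_i)\neq0$ for all $i$ simultaneously. \end{enumerate} -/

import Mathlib

universe u

noncomputable section

/-- An ADT network with supernode set `V`, input ports `I` and output ports `O`.  Every port belongs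
to one supernode; `edge e e'` says that there is an edge from the output port `e` to the input
port `e'`. -/
structure ADTNetwork (V I O : Type*) where
  /-- the supernode owning an input port -/
  inNode : I → V
  /-- the supernode owning an output port -/
  outNode : O → V
  /-- the edges, from output ports to input ports -/
  edge : O → I → Prop

/-- An assignment, with values in `K`, of the coding variables for `R` source processes and `N`
destinations: `α k e` (encoding of process `k` on the output port `e` of the source), `β e' e`
(coding from input port `e'` to output port `e` of the same supernode) and `ε e' i k` (weight of
the input port `e'` of destination `i` in its `k`-th decoded process).  Values at ports to which a
variable does not apply are never used. -/
structure ADTCode (I O K : Type*) (N R : ℕ) where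
  /-- encoding variables -/
  α : Fin R → O → K
  /-- internal coding variables -/
  β : I → O → K
  /-- decoding variables -/
  ε : I → Fin N → Fin R → K

namespace ADTNetwork

/-- There is an edge from supernode `v` to supernode `w`. -/
def Adj {V I O : Type*} (G : ADTNetwork V I O) (v w : V) : Prop :=
  ∃ (e : O) (e' : I), G.outNode e = v ∧ G.inNode e' = w ∧ G.edge e e'

/-- The network has no directed cycle. -/
def Acyclic {V I O : Type*} (G : ADTNetwork V I O) : Prop :=
  ∀ v : V, ¬ Relation.TransGen G.Adj v v

/-! ### Cuts -/

/-- `Ω` is a cut between `s` and `t`. -/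
def IsCut {V : Type*} (s t : V) (Ω : Set V) : Prop := s ∈ Ω ∧ t ∉ Ω

open Classical in
/-- The incidence matrix, over `K`, of the bipartite graph of the edges that lead from the output
ports in `Ω` to the input ports in the complement of `Ω`. -/
def cutMatrix {V I O : Type*} (G : ADTNetwork V I O) (K : Type*) [Field K] (Ω : Set V) :
    Matrix {e : O // G.outNode e ∈ Ω} {e' : I // G.inNode e' ∉ Ω} K :=
  Matrix.of fun e e' => if G.edge e.1 e'.1 then 1 else 0

open Classical in
/-- The minimum over all cuts between `s` and `t` of the rank over `K` of the cut matrix. -/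
def mincut {V I O : Type*} [Fintype I] (G : ADTNetwork V I O) (K : Type*) [Field K] (s t : V) : ℕ :=
  sInf {r : ℕ | ∃ Ω : Set V, IsCut s t Ω ∧ r = (G.cutMatrix K Ω).rank}

/-! ### Processes on the ports, and solvability -/

open Classical in
/-- The symbols `yI`, `yO` on the input and output ports are those produced by the code `c` from the
source symbols `x` at the source `S`: superposition at the input ports, linear coding at the
output ports, plus the encoded source symbols at the output ports of `S`. -/
def IsTransmission {V I O : Type*} [Fintype I] [Fintype O] (G : ADTNetwork V I O)
    {K : Type*} [Field K] {N R : ℕ} (S : V) (c : ADTCode I O K N R)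
    (x : Fin R → K) (yI : I → K) (yO : O → K) : Prop :=
  (∀ e' : I, yI e' = ∑ e : O, if G.edge e e' then yO e else 0) ∧
  (∀ e : O, yO e =
    (∑ e' : I, if G.inNode e' = G.outNode e then c.β e' e * yI e' else 0) +
      if G.outNode e = S then ∑ k : Fin R, c.α k e * x k else 0)

open Classical in
/-- The `k`-th process decoded by destination `i`, located at supernode `T i`. -/
def decoded {V I O : Type*} [Fintype I] (G : ADTNetwork V I O)
    {K : Type*} [Field K] {N R : ℕ} (T : Fin N → V) (c : ADTCode I O K N R)
    (yI : I → K) (i : Fin N) (k : Fin R) : K :=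
  ∑ e' : I, if G.inNode e' = T i then c.ε e' i k * yI e' else 0

/-- The multicast problem of `R` source processes from `S` to all `T i` is solvable over `K`: some
code lets every destination reproduce the source symbols, whatever these are. -/
def Solvable {V I O : Type*} [Fintype I] [Fintype O] (G : ADTNetwork V I O)
    (K : Type*) [Field K] {N : ℕ} (S : V) (T : Fin N → V) (R : ℕ) : Prop :=
  ∃ c : ADTCode I O K N R, ∀ x : Fin R → K,
    (∃ yI yO, G.IsTransmission S c x yI yO) ∧
    ∀ yI yO, G.IsTransmission S c x yI yO → ∀ i, G.decoded T c yI i = x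

/-! ### The system matrix -/

open Classical in
/-- The adjacency matrix `F`, indexed by the ports. -/
def adjMatrix {V I O : Type*} (G : ADTNetwork V I O)
    {K : Type*} [Field K] {N R : ℕ} (c : ADTCode I O K N R) : Matrix (I ⊕ O) (I ⊕ O) K :=
  Matrix.of fun p p' => match p, p' with
    | Sum.inr e, Sum.inl e' => if G.edge e e' then 1 else 0
    | Sum.inl e', Sum.inr e => if G.inNode e' = G.outNode e then c.β e' e else 0
    | _, _ => 0

open Classical in
/-- The encoding matrix `A`. -/
def encMatrix {V I O : Type*} (G : ADTNetwork V I O)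
    {K : Type*} [Field K] {N R : ℕ} (S : V) (c : ADTCode I O K N R) : Matrix (Fin R) (I ⊕ O) K :=
  Matrix.of fun k p => match p with
    | Sum.inr e => if G.outNode e = S then c.α k e else 0
    | Sum.inl _ => 0

open Classical in
/-- The decoding matrix `B_i` of destination `i`. -/
def decMatrix {V I O : Type*} (G : ADTNetwork V I O)
    {K : Type*} [Field K] {N R : ℕ} (T : Fin N → V) (c : ADTCode I O K N R) (i : Fin N) :
    Matrix (Fin R) (I ⊕ O) K :=
  Matrix.of fun k p => match p with
    | Sum.inl e' => if G.inNode e' = T i then c.ε e' i k else 0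
    | Sum.inr _ => 0

open Classical in
/-- The system matrix `M_i = A (1 - F)⁻¹ B_iᵀ` of destination `i`. -/
def systemMatrix {V I O : Type*} [Fintype I] [Fintype O] (G : ADTNetwork V I O)
    {K : Type*} [Field K] {N R : ℕ} (S : V) (T : Fin N → V) (c : ADTCode I O K N R) (i : Fin N) :
    Matrix (Fin R) (Fin R) K :=
  G.encMatrix S c * (1 - G.adjMatrix c)⁻¹ * (G.decMatrix T c i).transpose

end ADTNetwork

end

/-!
By the Schur complement formula, `det Mᵢ ≠ 0` if and only if the block matrix
`[[0, A], [Bᵢᵀ, F - 1]]` is nonsingular. In that matrix every coding variable is a single entry, and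
the other entries are constants. If the entries at a set `E` of positions of a matrix are chosen
freely over an infinite field, the largest rank is the minimum, over the covers of `E` by rows and
columns, of the number of lines plus the rank of what remains after deleting them. For the block
matrix the diagonal entries `-1` make it enough to consider the covers by all rows sitting outside a
set `Ω` of supernodes and all columns sitting in `Ω`. What such a cover leaves is the cut matrix of
`Ω`, so that the condition on covers becomes the condition on cuts.

The determinants, as polynomials in the coding variables, have degree at most one in each variable.
If they are nonzero, the product of the `N` of them therefore has a nonzero value over any field
with more than `N` elements.
-/

open Matrix

section Rank

variable {m n K : Type*} [Field K]

theorem rank_add_le_rank_add_rank [Finite m] [Fintype n] (A B : Matrix m n K) :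
    (A + B).rank ≤ A.rank + B.rank := by
  refine (Submodule.finrank_mono ?_).trans (Submodule.finrank_add_le_finrank_add_finrank _ _)
  rintro _ ⟨v, rfl⟩
  rw [mulVecLin_add, LinearMap.add_apply]
  exact Submodule.add_mem_sup ⟨v, rfl⟩ ⟨v, rfl⟩

theorem le_matrix_rank_iff_exists_linearIndependent [Finite m] [Fintype n] (A : Matrix m n K)
    (r : ℕ) : r ≤ A.rank ↔ ∃ f : Fin r → m, LinearIndependent K (A.row ∘ f) := by
  cases nonempty_fintype m
  constructor
  · intro hr
    rw [A.rank_eq_finrank_span_row] at hr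
    obtain ⟨b, hb, -, hli⟩ := Submodule.exists_fun_fin_finrank_span_eq K (Set.range A.row)
    choose f hf using hb
    refine ⟨f ∘ Fin.castLE hr, ?_⟩
    have hrow : A.row ∘ f = b := funext hf
    rw [← Function.comp_assoc, hrow]
    exact hli.comp _ (Fin.castLE_injective hr)
  · rintro ⟨f, hf⟩
    calc r = (A.submatrix f id).rank := by
          rw [LinearIndependent.rank_matrix (M := A.submatrix f id) hf, Fintype.card_fin]
      _ ≤ A.rank := rank_submatrix_le A f id

theorem rank_map_algebraMap [Finite m] [Fintype n] (L : Type*) [Field L] [Algebra K L]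
    (A : Matrix m n K) : (A.map (algebraMap K L)).rank = A.rank := by
  refine eq_of_forall_le_iff fun r => ?_
  rw [le_matrix_rank_iff_exists_linearIndependent, le_matrix_rank_iff_exists_linearIndependent]
  exact exists_congr fun f => linearIndependent_algebraMap_comp_iff (v := A.row ∘ f)

theorem det_ne_zero_iff_card_le_rank [Fintype n] [DecidableEq n] {M : Matrix n n K} :
    M.det ≠ 0 ↔ Fintype.card n ≤ M.rank := by
  refine ⟨fun h => (rank_of_det_ne_zero h).ge, fun h => ?_⟩
  rw [← isUnit_iff_ne_zero, ← isUnit_iff_isUnit_det, ← linearIndependent_rows_iff_isUnit,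
    linearIndependent_iff_card_le_finrank_span, Set.finrank, ← rank_eq_finrank_span_row]
  exact h

theorem rank_le_rank_submatrix_of_col_support {n' : Type*} [Finite m] [Fintype n] [Fintype n']
    {g : n' → n} {M : Matrix m n K} (hM : ∀ i j, M i j ≠ 0 → j ∈ Set.range g) :
    M.rank ≤ (M.submatrix id g).rank := by
  cases nonempty_fintype m
  simp only [rank_eq_finrank_span_cols]
  refine Submodule.finrank_mono (Submodule.span_le.2 ?_)
  rintro _ ⟨j, rfl⟩
  by_cases hj : ∃ i, M i j ≠ 0
  · obtain ⟨i, hi⟩ := hj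
    obtain ⟨k, rfl⟩ := hM i j hi
    exact Submodule.subset_span ⟨k, rfl⟩
  · rw [show M.col j = 0 from funext fun i => not_not.1 (not_exists.1 hj i)]
    exact Submodule.zero_mem _

theorem rank_submatrix_eq_of_support {m' n' : Type*} [Finite m] [Finite m'] [Fintype n]
    [Fintype n'] {f : m' → m} {g : n' → n} {M : Matrix m n K}
    (hM : ∀ i j, M i j ≠ 0 → i ∈ Set.range f ∧ j ∈ Set.range g) :
    (M.submatrix f g).rank = M.rank := by
  cases nonempty_fintype m
  cases nonempty_fintype m'
  refine le_antisymm (rank_submatrix_le M f g) ?_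
  calc M.rank ≤ (M.submatrix id g).rank :=
        rank_le_rank_submatrix_of_col_support fun i j h => (hM i j h).2
    _ = (M.submatrix id g)ᵀ.rank := (rank_transpose _).symm
    _ ≤ ((M.submatrix id g)ᵀ.submatrix id f).rank :=
        rank_le_rank_submatrix_of_col_support fun j i h => (hM i (g j) h).1
    _ = (M.submatrix f g).rank := rank_transpose (M.submatrix f g)

end Rank

section EraseLines

variable {m n K : Type*} [DecidableEq m] [DecidableEq n]

/-- The matrix `M` with its lines at `C` (rows) and `D` (columns) replaced by zero. Keeping the
index types makes the deletions of different lines comparable. -/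
def eraseLines [Zero K] (C : Finset m) (D : Finset n) (M : Matrix m n K) : Matrix m n K :=
  of fun i j => if i ∈ C ∨ j ∈ D then 0 else M i j

theorem eraseLines_apply [Zero K] (C : Finset m) (D : Finset n) (M : Matrix m n K) (i : m)
    (j : n) : eraseLines C D M i j = if i ∈ C ∨ j ∈ D then 0 else M i j :=
  rfl

theorem eraseLines_empty [Zero K] (M : Matrix m n K) : eraseLines ∅ ∅ M = M := by
  ext i j
  simp [eraseLines_apply]

theorem eraseLines_eraseLines [Zero K] (C C' : Finset m) (D D' : Finset n) (M : Matrix m n K) :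
    eraseLines C D (eraseLines C' D' M) = eraseLines (C ∪ C') (D ∪ D') M := by
  ext i j
  simp only [eraseLines_apply, Finset.mem_union, ← ite_or]
  congr 1
  grind

theorem transpose_eraseLines [Zero K] (C : Finset m) (D : Finset n) (M : Matrix m n K) :
    (eraseLines C D M)ᵀ = eraseLines D C Mᵀ := by
  ext j i
  simp only [transpose_apply, eraseLines_apply, or_comm]

theorem eraseLines_map {L F : Type*} [Zero K] [Zero L] [FunLike F K L] [ZeroHomClass F K L]
    (f : F) (C : Finset m) (D : Finset n) (M : Matrix m n K) :
    eraseLines C D (M.map f) = (eraseLines C D M).map f := by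
  ext i j
  simp only [eraseLines_apply, map_apply, apply_ite f, map_zero]

theorem eraseLines_add [AddZeroClass K] (C : Finset m) (D : Finset n) (M N : Matrix m n K) :
    eraseLines C D (M + N) = eraseLines C D M + eraseLines C D N := by
  ext i j
  simp only [eraseLines_apply, Matrix.add_apply]
  split_ifs <;> simp only [add_zero]

theorem eraseLines_single_of_mem [Zero K] {C : Finset m} {D : Finset n} {x : m} {y : n}
    (hxy : x ∈ C ∨ y ∈ D) (t : K) : eraseLines C D (single x y t) = 0 := by
  ext i j
  simp only [eraseLines_apply, single_apply, Matrix.zero_apply]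
  grind

theorem eraseLines_single_of_notMem [Zero K] {C : Finset m} {D : Finset n} {x : m} {y : n}
    (hx : x ∉ C) (hy : y ∉ D) (t : K) : eraseLines C D (single x y t) = single x y t := by
  ext i j
  simp only [eraseLines_apply, single_apply]
  grind

variable [Field K]

theorem span_row_eraseLines_rows_le (C : Finset m) (M : Matrix m n K) :
    Submodule.span K (Set.range (eraseLines C ∅ M).row) ≤ Submodule.span K (Set.range M.row) := by
  refine Submodule.span_le.2 ?_
  rintro _ ⟨i, rfl⟩
  by_cases hi : i ∈ C
  · rw [show (eraseLines C ∅ M).row i = 0 from funext fun j => if_pos (Or.inl hi)]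
    exact Submodule.zero_mem _
  · exact Submodule.subset_span ⟨i, funext fun j => (if_neg (by simpa using hi)).symm⟩

theorem row_eraseLines_cols (D : Finset n) (M : Matrix m n K) (i : m) :
    (eraseLines ∅ D M).row i = M.row i - ∑ j ∈ D, M i j • Pi.single j 1 := by
  ext j
  simp only [row, eraseLines_apply, Finset.notMem_empty, false_or, Pi.sub_apply,
    Finset.sum_apply, Pi.smul_apply, Pi.single_apply, smul_eq_mul, mul_ite, mul_one, mul_zero,
    Finset.sum_ite_eq]
  grind

theorem rank_le_card_add_rank_eraseLines_rows [Finite m] [Fintype n] (C : Finset m)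
    (M : Matrix m n K) : M.rank ≤ C.card + (eraseLines C ∅ M).rank := by
  have hsupport : Function.support (M - eraseLines C ∅ M).row ⊆ (C : Set m) := by
    rw [Function.support_subset_iff']
    intro i hi
    ext j
    simp [row, eraseLines_apply, Finset.mem_coe.not.1 hi]
  cases nonempty_fintype m
  calc M.rank = (M - eraseLines C ∅ M + eraseLines C ∅ M).rank := by rw [sub_add_cancel]
    _ ≤ (M - eraseLines C ∅ M).rank + (eraseLines C ∅ M).rank := rank_add_le_rank_add_rank _ _
    _ ≤ C.card + (eraseLines C ∅ M).rank :=
        Nat.add_le_add_right (rank_le_card_of_support_subset _ _ hsupport) _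

variable [Finite m] [Fintype n]

theorem rank_le_card_add_rank_eraseLines_cols (D : Finset n) (M : Matrix m n K) :
    M.rank ≤ D.card + (eraseLines ∅ D M).rank := by
  cases nonempty_fintype m
  rw [← rank_transpose, ← rank_transpose (eraseLines ∅ D M), transpose_eraseLines]
  exact rank_le_card_add_rank_eraseLines_rows D Mᵀ

theorem card_add_card_add_rank_eraseLines_le_of_subset {C C' : Finset m} {D D' : Finset n}
    (hC : C' ⊆ C) (hD : D' ⊆ D) (M : Matrix m n K) :
    C'.card + D'.card + (eraseLines C' D' M).rank ≤ C.card + D.card + (eraseLines C D M).rank := by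
  have hrows := rank_le_card_add_rank_eraseLines_rows (C \ C') (eraseLines C' D' M)
  have hcols := rank_le_card_add_rank_eraseLines_cols (D \ D') (eraseLines C D' M)
  rw [eraseLines_eraseLines, Finset.sdiff_union_of_subset hC, Finset.empty_union] at hrows
  rw [eraseLines_eraseLines, Finset.sdiff_union_of_subset hD, Finset.empty_union] at hcols
  have hC_card := Finset.card_sdiff_add_card_eq_card hC
  have hD_card := Finset.card_sdiff_add_card_eq_card hD
  omega

theorem card_add_rank_eraseLines_cols_le {D : Finset n} {M : Matrix m n K}
    (hD : ∀ j ∈ D, Pi.single j 1 ∈ Submodule.span K (Set.range M.row)) :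
    D.card + (eraseLines ∅ D M).rank ≤ M.rank := by
  cases nonempty_fintype m
  let U := Submodule.span K (Set.range fun j : D => (Pi.single j 1 : n → K))
  let W := Submodule.span K (Set.range (eraseLines ∅ D M).row)
  have hU_finrank : Module.finrank K U = D.card := by
    have hli := (Pi.linearIndependent_single_one n K).comp ((↑) : D → n) Subtype.val_injective
    exact (finrank_span_eq_card hli).trans (Fintype.card_coe D)
  have hU : U ≤ Submodule.pi (D : Set n)ᶜ fun _ => ⊥ := by
    refine Submodule.span_le.2 ?_
    rintro _ ⟨j, rfl⟩ k hk
    exact Pi.single_eq_of_ne (fun h : k = j => hk (h ▸ j.2)) 1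
  have hW : W ≤ Submodule.pi (D : Set n) fun _ => ⊥ := by
    refine Submodule.span_le.2 ?_
    rintro _ ⟨i, rfl⟩ k hk
    exact if_pos (Or.inr hk)
  have hdisjoint : U ⊓ W = ⊥ := by
    refine (Submodule.eq_bot_iff _).2 fun v hv => funext fun j => ?_
    by_cases hj : j ∈ D
    · exact hW hv.2 j hj
    · exact hU hv.1 j hj
  have hsup : U ⊔ W ≤ Submodule.span K (Set.range M.row) := by
    have hU_le : U ≤ Submodule.span K (Set.range M.row) :=
      Submodule.span_le.2 (Set.range_subset_iff.2 fun j => hD j j.2)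
    refine sup_le hU_le (Submodule.span_le.2 ?_)
    rintro _ ⟨i, rfl⟩
    rw [row_eraseLines_cols]
    exact Submodule.sub_mem _ (Submodule.subset_span ⟨i, rfl⟩)
      (Submodule.sum_mem _ fun j hj => Submodule.smul_mem _ _ (hD j hj))
  calc D.card + (eraseLines ∅ D M).rank = Module.finrank K (U ⊔ W : Submodule K (n → K)) := by
        rw [← hU_finrank, rank_eq_finrank_span_row, ← Submodule.finrank_sup_add_finrank_inf_eq U W,
          hdisjoint, finrank_bot, add_zero]
    _ ≤ M.rank := by
        rw [rank_eq_finrank_span_row]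
        exact Submodule.finrank_mono hsup

theorem card_add_rank_eraseLines_rows_le {C : Finset m} {M : Matrix m n K}
    (hC : ∀ i ∈ C, Pi.single i 1 ∈ Submodule.span K (Set.range M.col)) :
    C.card + (eraseLines C ∅ M).rank ≤ M.rank := by
  cases nonempty_fintype m
  rw [← rank_transpose, ← rank_transpose M, transpose_eraseLines]
  exact card_add_rank_eraseLines_cols_le hC

theorem row_mem_span_row_eraseLines {C : Finset m} {M : Matrix m n K}
    (hM : M.rank ≤ (eraseLines C ∅ M).rank) (i : m) :
    M.row i ∈ Submodule.span K (Set.range (eraseLines C ∅ M).row) := by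
  cases nonempty_fintype m
  rw [rank_eq_finrank_span_row, rank_eq_finrank_span_row] at hM
  rw [Submodule.eq_of_le_of_finrank_le (span_row_eraseLines_rows_le C M) hM]
  exact Submodule.subset_span ⟨i, rfl⟩

theorem le_rank_add_single_or (M : Matrix m n K) (x : m) (y : n) {t t' : K} (ht : t ≠ t') {r : ℕ}
    (hx : r ≤ 1 + (eraseLines {x} ∅ M).rank) (hy : r ≤ 1 + (eraseLines ∅ {y} M).rank) :
    r ≤ (M + single x y t).rank ∨ r ≤ (M + single x y t').rank := by
  by_contra! ⟨hlt, hlt'⟩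
  -- If both values fail, row `x` lies in the span `W` of the other rows for both of them, and the
  -- difference of the two rows puts `e_y` in `W`, so that erasing column `y` lowers the rank.
  set W := Submodule.span K (Set.range (eraseLines {x} ∅ M).row)
  have hrows : ∀ s, eraseLines {x} ∅ (M + single x y s) = eraseLines {x} ∅ M := fun s => by
    rw [eraseLines_add, eraseLines_single_of_mem (by simp), add_zero]
  have hcols : ∀ s, eraseLines ∅ {y} (M + single x y s) = eraseLines ∅ {y} M := fun s => by
    rw [eraseLines_add, eraseLines_single_of_mem (by simp), add_zero]
  have hrow_mem : ∀ s, (M + single x y s).rank < r → (M + single x y s).row x ∈ W := fun s hs => by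
    have hmem := row_mem_span_row_eraseLines (C := {x}) (M := M + single x y s)
      (by rw [hrows]; omega) x
    rwa [hrows] at hmem
  have hsingle : Pi.single y 1 ∈ W := by
    have hsub := W.smul_mem (t - t')⁻¹ (W.sub_mem (hrow_mem t hlt) (hrow_mem t' hlt'))
    convert hsub using 1
    ext j
    by_cases hj : y = j
    · subst hj
      simp [row, sub_ne_zero.2 ht]
    · simp [row, hj]
  have hW : W ≤ Submodule.span K (Set.range (M + single x y t).row) := by
    simpa only [hrows] using span_row_eraseLines_rows_le {x} (M + single x y t)
  have hrank := card_add_rank_eraseLines_cols_le (D := {y}) (M := M + single x y t)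
    (by simpa using hW hsingle)
  rw [hcols, Finset.card_singleton] at hrank
  omega

end EraseLines

section Cover

variable {m n K : Type*} [Finite m] [Fintype n] [DecidableEq m] [DecidableEq n] [Field K]

theorem subsingleton_setOf_rank_eraseLines_add_single_lt {Q : Matrix m n K} {C : Finset m}
    {D : Finset n} {x : m} {y : n} {r : ℕ}
    (hx : r ≤ (insert x C).card + D.card + (eraseLines (insert x C) D Q).rank)
    (hy : r ≤ C.card + (insert y D).card + (eraseLines C (insert y D) Q).rank) :
    {t : K | C.card + D.card + (eraseLines C D (Q + single x y t)).rank < r}.Subsingleton := by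
  by_cases hxy : x ∈ C ∨ y ∈ D
  · have hr : r ≤ C.card + D.card + (eraseLines C D Q).rank := by
      rcases hxy with h | h
      · rwa [Finset.insert_eq_of_mem h] at hx
      · rwa [Finset.insert_eq_of_mem h] at hy
    intro t ht
    rw [Set.mem_ofPred_eq, eraseLines_add, eraseLines_single_of_mem hxy, add_zero] at ht
    omega
  · obtain ⟨hxC, hyD⟩ := not_or.1 hxy
    intro t ht t' ht'
    by_contra hne
    rw [Set.mem_ofPred_eq, eraseLines_add, eraseLines_single_of_notMem hxC hyD] at ht ht'
    rw [← Finset.singleton_union, ← Finset.empty_union D, ← eraseLines_eraseLines,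
      Finset.empty_union, Finset.singleton_union, Finset.card_insert_of_notMem hxC] at hx
    rw [← Finset.singleton_union, ← Finset.empty_union C, ← eraseLines_eraseLines,
      Finset.empty_union, Finset.singleton_union, Finset.card_insert_of_notMem hyD] at hy
    have := le_rank_add_single_or (eraseLines C D Q) x y hne (r := r - (C.card + D.card))
      (by omega) (by omega)
    omega

theorem exists_le_rank_add_of_forall_cover [Infinite K] (E : Finset (m × n)) {r : ℕ}
    {Q : Matrix m n K} (hQ : ∀ (C : Finset m) (D : Finset n), (∀ p ∈ E, p.1 ∈ C ∨ p.2 ∈ D) →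
      r ≤ C.card + D.card + (eraseLines C D Q).rank) :
    ∃ X : Matrix m n K, (∀ i j, (i, j) ∉ E → X i j = 0) ∧ r ≤ (Q + X).rank := by
  induction E using Finset.induction_on generalizing Q with
  | empty => exact ⟨0, fun _ _ _ => rfl, by simpa [eraseLines_empty] using hQ ∅ ∅ (by simp)⟩
  | insert p E hp ih =>
    obtain ⟨x, y⟩ := p
    have hfinite : (⋃ CD ∈ {CD : Finset m × Finset n | ∀ p ∈ E, p.1 ∈ CD.1 ∨ p.2 ∈ CD.2},
        {t : K | CD.1.card + CD.2.card + (eraseLines CD.1 CD.2 (Q + single x y t)).rank <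
          r}).Finite := by
      refine (Set.toFinite _).biUnion fun CD hCD => ?_
      exact (subsingleton_setOf_rank_eraseLines_add_single_lt (hQ _ _ (by grind))
        (hQ _ _ (by grind))).finite
    obtain ⟨t, ht⟩ := hfinite.exists_notMem
    simp only [Set.mem_iUnion, Set.mem_ofPred_eq, not_exists, not_lt] at ht
    obtain ⟨X, hX, hr⟩ := ih fun C D hCD => ht (C, D) hCD
    refine ⟨single x y t + X, fun i j hij => ?_, by rwa [← add_assoc]⟩
    rw [Finset.mem_insert, not_or] at hij
    rw [Matrix.add_apply, hX i j hij.2, single_apply_of_ne, add_zero]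
    rintro ⟨rfl, rfl⟩
    exact hij.1 rfl

end Cover

section MixedMatrix

variable {m n σ R K : Type*}

/-- A mixed matrix in the sense of Murota, evaluated at `v`: the constant matrix `Q` with the
variable `s` added at the entry `(i, j)` if `var i j = some s`. That each variable occurs only once
is not part of the definition. -/
def mixedMatrix [AddZeroClass R] (Q : Matrix m n R) (var : m → n → Option σ) (v : σ → R) :
    Matrix m n R :=
  of fun i j => Q i j + (var i j).elim 0 v

theorem mixedMatrix_map {S F : Type*} [AddZeroClass R] [AddZeroClass S] [FunLike F R S]
    [AddMonoidHomClass F R S] (f : F) (Q : Matrix m n R) (var : m → n → Option σ) (v : σ → R) :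
    (mixedMatrix Q var v).map f = mixedMatrix (Q.map f) var (f ∘ v) := by
  ext i j
  cases h : var i j <;> simp [mixedMatrix, h]

theorem exists_le_rank_mixedMatrix [Finite m] [Fintype n] [DecidableEq m] [DecidableEq n]
    [Field K] [Infinite K] {r : ℕ} {Q : Matrix m n K} {var : m → n → Option σ}
    (hvar : ∀ s, {p : m × n | s ∈ var p.1 p.2}.Subsingleton)
    (hQ : ∀ (C : Finset m) (D : Finset n), (∀ i j, var i j ≠ none → i ∈ C ∨ j ∈ D) →
      r ≤ C.card + D.card + (eraseLines C D Q).rank) :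
    ∃ v : σ → K, r ≤ (mixedMatrix Q var v).rank := by
  classical
  cases nonempty_fintype m
  obtain ⟨X, hX, hr⟩ := exists_le_rank_add_of_forall_cover
    ({p | var p.1 p.2 ≠ none} : Finset (m × n)) (Q := Q) (r := r)
    fun C D hCD => hQ C D fun i j hij => hCD (i, j) (by simpa using hij)
  refine ⟨fun s => if h : ∃ p : m × n, s ∈ var p.1 p.2 then X h.choose.1 h.choose.2 else 0, ?_⟩
  convert hr using 2
  ext i j
  cases hij : var i j with
  | none => simp [mixedMatrix, hij, hX]
  | some s =>
    have hs : ∃ p : m × n, s ∈ var p.1 p.2 := ⟨(i, j), hij⟩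
    have hchoose : hs.choose = (i, j) := hvar s hs.choose_spec hij
    simp only [mixedMatrix, of_apply, hij, Option.elim_some, dif_pos hs, hchoose,
      Matrix.add_apply]

theorem degreeOf_det_le [Fintype n] [DecidableEq n] [CommRing R] (s : σ)
    {M : Matrix n n (MvPolynomial σ R)} {d : n → ℕ} (hM : ∀ i j, (M i j).degreeOf s ≤ d i) :
    M.det.degreeOf s ≤ ∑ i, d i := by
  rw [det_apply']
  refine (MvPolynomial.degreeOf_sum_le _ _ _).trans (Finset.sup_le fun τ _ => ?_)
  calc MvPolynomial.degreeOf s (((Equiv.Perm.sign τ : ℤ) : MvPolynomial σ R) * ∏ i, M (τ i) i) =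
        MvPolynomial.degreeOf s
          (MvPolynomial.C ((Equiv.Perm.sign τ : ℤ) : R) * ∏ i, M (τ i) i) := by rw [map_intCast]
    _ ≤ ∑ i, MvPolynomial.degreeOf s (M (τ i) i) :=
        (MvPolynomial.degreeOf_C_mul_le _ _ _).trans (MvPolynomial.degreeOf_prod_le _ _ _)
    _ ≤ ∑ i, d (τ i) := Finset.sum_le_sum fun i _ => hM (τ i) i
    _ = ∑ i, d i := Equiv.sum_comp τ d

theorem degreeOf_det_mixedMatrix_X_le [Fintype n] [DecidableEq n] [CommRing R] [Nontrivial R]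
    {var : n → n → Option σ} {s : σ} (hvar : {p : n × n | s ∈ var p.1 p.2}.Subsingleton)
    (Q : Matrix n n R) :
    (mixedMatrix (Q.map MvPolynomial.C) var MvPolynomial.X).det.degreeOf s ≤ 1 := by
  classical
  let rows : Finset n := {i | ∃ j, s ∈ var i j}
  have hrows : rows.card ≤ 1 := Finset.card_le_one.2 fun i hi i' hi' => by
    obtain ⟨j, hj⟩ := (Finset.mem_filter.1 hi).2
    obtain ⟨j', hj'⟩ := (Finset.mem_filter.1 hi').2
    exact congrArg Prod.fst (hvar (show (i, j) ∈ _ from hj) (show (i', j') ∈ _ from hj'))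
  have hentry : ∀ i j, (mixedMatrix (Q.map MvPolynomial.C) var MvPolynomial.X i j).degreeOf s ≤
      if i ∈ rows then 1 else 0 := by
    intro i j
    refine (MvPolynomial.degreeOf_add_le _ _ _).trans (max_le ?_ ?_)
    · simp [MvPolynomial.degreeOf_C]
    · cases hij : var i j with
      | none => simp
      | some s' =>
        rw [Option.elim_some, MvPolynomial.degreeOf_X]
        split_ifs with hs hi
        · exact le_rfl
        · exact absurd (Finset.mem_filter.2 ⟨Finset.mem_univ i, j, hs ▸ hij⟩) hi
        all_goals exact zero_le
  calc _ ≤ ∑ i, if i ∈ rows then 1 else 0 := degreeOf_det_le s hentry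
    _ = rows.card := by simp
    _ ≤ 1 := hrows

theorem exists_forall_eval_ne_zero {ι : Type*} [Finite σ] [Fintype ι] [CommRing R] [IsDomain R]
    {p : ι → MvPolynomial σ R} (hp : ∀ i, p i ≠ 0) {d : ℕ} (hd : ∀ i s, (p i).degreeOf s ≤ d)
    {A : Finset R} (hA : Fintype.card ι * d < A.card) :
    ∃ v : σ → R, (∀ s, v s ∈ A) ∧ ∀ i, MvPolynomial.eval v (p i) ≠ 0 := by
  by_contra! hzero
  have hprod : ∏ i, p i = 0 := by
    refine MvPolynomial.eq_zero_of_eval_zero_at_prod_finset _ (fun _ => A) (fun s => ?_) ?_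
    · calc (∏ i, p i).degreeOf s ≤ ∑ i, (p i).degreeOf s := MvPolynomial.degreeOf_prod_le _ _ _
        _ ≤ ∑ _i : ι, d := Finset.sum_le_sum fun i _ => hd i s
        _ = Fintype.card ι * d := by simp
        _ < A.card := hA
    · intro v hv
      obtain ⟨i, hi⟩ := hzero v hv
      rw [map_prod]
      exact Finset.prod_eq_zero (Finset.mem_univ i) hi
  obtain ⟨i, -, hi⟩ := Finset.prod_eq_zero_iff.1 hprod
  exact hp i hi

theorem det_mixedMatrix_X_ne_zero [Fintype n] [DecidableEq n] [Field K]
    {Q : Matrix n n K} {var : n → n → Option σ}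
    (hvar : ∀ s, {p : n × n | s ∈ var p.1 p.2}.Subsingleton)
    (hQ : ∀ C D : Finset n, (∀ i j, var i j ≠ none → i ∈ C ∨ j ∈ D) →
      Fintype.card n ≤ C.card + D.card + (eraseLines C D Q).rank) :
    (mixedMatrix (Q.map MvPolynomial.C) var MvPolynomial.X).det ≠ 0 := by
  obtain ⟨v, hv⟩ := exists_le_rank_mixedMatrix (K := AlgebraicClosure K)
    (Q := Q.map (algebraMap K _)) hvar fun C D hCD => by
      rw [eraseLines_map, rank_map_algebraMap]
      exact hQ C D hCD
  rw [← det_ne_zero_iff_card_le_rank] at hv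
  refine fun hzero => hv ?_
  have heval := congrArg (MvPolynomial.aeval v) hzero
  rw [map_zero, AlgHom.map_det, AlgHom.mapMatrix_apply, mixedMatrix_map, map_map] at heval
  have hX : MvPolynomial.aeval (R := K) v ∘ MvPolynomial.X = v := funext (MvPolynomial.aeval_X v)
  have hC : MvPolynomial.aeval (R := K) v ∘ MvPolynomial.C = algebraMap K _ :=
    funext (MvPolynomial.aeval_C v)
  rwa [hX, hC] at heval

theorem exists_forall_det_mixedMatrix_ne_zero {ι : Type*} [Fintype ι] [Finite σ] [Fintype n]
    [DecidableEq n] [Field K] {A : Finset K} (hA : Fintype.card ι < A.card) {Q : ι → Matrix n n K}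
    {var : ι → n → n → Option σ}
    (hvar : ∀ i s, {p : n × n | s ∈ var i p.1 p.2}.Subsingleton)
    (hQ : ∀ i, ∀ C D : Finset n, (∀ a b, var i a b ≠ none → a ∈ C ∨ b ∈ D) →
      Fintype.card n ≤ C.card + D.card + (eraseLines C D (Q i)).rank) :
    ∃ v : σ → K, (∀ s, v s ∈ A) ∧ ∀ i, (mixedMatrix (Q i) (var i) v).det ≠ 0 := by
  obtain ⟨v, hvA, hv⟩ := exists_forall_eval_ne_zero
    (fun i => det_mixedMatrix_X_ne_zero (hvar i) (hQ i))
    (fun i s => degreeOf_det_mixedMatrix_X_le (hvar i s) (Q i))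
    (by rwa [mul_one])
  refine ⟨v, hvA, fun i => ?_⟩
  have hvi := hv i
  rw [RingHom.map_det, RingHom.mapMatrix_apply, mixedMatrix_map, map_map] at hvi
  have hX : MvPolynomial.eval v ∘ MvPolynomial.X = v := funext fun _ => MvPolynomial.eval_X _
  have hC : MvPolynomial.eval v ∘ MvPolynomial.C = id := funext fun _ => MvPolynomial.eval_C _
  rwa [hX, hC, map_id] at hvi

end MixedMatrix

section Cardinality

theorem exists_finset_card_eq_of_le_card {α : Type*} {n : ℕ} (h : (n : ℕ∞) ≤ ENat.card α) :
    ∃ A : Finset α, A.card = n := by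
  rw [← Set.encard_univ] at h
  obtain ⟨A, -, hA⟩ := Set.exists_subset_encard_eq h
  lift A to Finset α using Set.finite_of_encard_eq_coe hA
  exact ⟨A, by exact_mod_cast hA⟩

theorem exists_finiteDimensional_extension_lt_card (F : Type u) [Field F] (n : ℕ) :
    ∃ (K : Type u) (_ : Field K) (_ : Algebra F K), FiniteDimensional F K ∧
      (n : ℕ∞) < ENat.card K := by
  obtain ⟨A, hA⟩ := Infinite.exists_subset_card_eq (AlgebraicClosure F) (n + 1)
  refine ⟨IntermediateField.adjoin F (A : Set (AlgebraicClosure F)), inferInstance, inferInstance,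
    IntermediateField.finiteDimensional_adjoin fun x _ =>
      (Algebra.IsAlgebraic.isAlgebraic (R := F) x).isIntegral, ?_⟩
  calc (n : ℕ∞) < (n + 1 : ℕ) := by exact_mod_cast Nat.lt_succ_self n
    _ = (A : Set (AlgebraicClosure F)).encard := by rw [Set.encard_coe_eq_coe_finsetCard, hA]
    _ ≤ (IntermediateField.adjoin F (A : Set (AlgebraicClosure F)) : Set _).encard :=
        Set.encard_le_encard (IntermediateField.subset_adjoin F _)

theorem exists_fintype_extension_iff {F : Type u} [Field F] [Finite F]
    (P : ∀ (K : Type u) [Field K], Prop) :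
    (∃ (K : Type u) (_ : Field K) (_ : Fintype K) (_ : Algebra F K), P K) ↔
      ∃ (K : Type u) (_ : Field K) (_ : Algebra F K), FiniteDimensional F K ∧ P K := by
  constructor
  · rintro ⟨K, hK, _, hFK, hP⟩
    exact ⟨K, hK, hFK, inferInstance, hP⟩
  · rintro ⟨K, hK, hFK, _, hP⟩
    have : Finite K := Module.finite_of_finite F
    exact ⟨K, hK, Fintype.ofFinite K, hFK, hP⟩

end Cardinality

namespace ADTNetwork

section Cuts

variable {V I O : Type*} (G : ADTNetwork V I O)

theorem cutMatrix_map_algebraMap (F K : Type*) [Field F] [Field K] [Algebra F K] (Ω : Set V) :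
    (G.cutMatrix F Ω).map (algebraMap F K) = G.cutMatrix K Ω := by
  ext e e'
  simp only [cutMatrix, map_apply, of_apply, apply_ite (algebraMap F K), map_one, map_zero]

variable [Fintype I]

open Classical in
theorem le_mincut_iff (K : Type*) [Field K] {s t : V} (hst : t ≠ s) {r : ℕ} :
    r ≤ G.mincut K s t ↔ ∀ Ω, IsCut s t Ω → r ≤ (G.cutMatrix K Ω).rank := by
  constructor
  · exact fun hr Ω hΩ => hr.trans (Nat.sInf_le ⟨Ω, hΩ, rfl⟩)
  · intro hr
    refine le_csInf ⟨_, {s}, ⟨rfl, hst⟩, rfl⟩ ?_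
    rintro _ ⟨Ω, hΩ, rfl⟩
    exact hr Ω hΩ

theorem mincut_algebraMap [Finite O] (F K : Type*) [Field F] [Field K] [Algebra F K] (s t : V) :
    G.mincut K s t = G.mincut F s t := by
  simp only [mincut, ← G.cutMatrix_map_algebraMap F K, rank_map_algebraMap]

end Cuts

section Transmission

open scoped Classical

variable {V I O : Type*} {G : ADTNetwork V I O}

theorem Acyclic.wellFounded_adj [Finite O] (hG : G.Acyclic) : WellFounded G.Adj := by
  have : IsTrans O (InvImage (Relation.TransGen G.Adj) G.outNode) :=
    ⟨fun _ _ _ => Relation.TransGen.trans⟩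
  have : Std.Irrefl (InvImage (Relation.TransGen G.Adj) G.outNode) := ⟨fun _ => hG _⟩
  have hwf := Finite.wellFounded_of_trans_of_irrefl (InvImage (Relation.TransGen G.Adj) G.outNode)
  have hacc : ∀ e, Acc G.Adj (G.outNode e) := fun e => by
    induction e using hwf.induction with
    | _ e ih =>
      refine Acc.intro _ ?_
      rintro _ ⟨f, f', rfl, hf', hff'⟩
      exact ih f (Relation.TransGen.single ⟨f, f', rfl, hf', hff'⟩)
  refine ⟨fun v => Acc.intro v ?_⟩
  rintro _ ⟨e, _, rfl, _⟩
  exact hacc e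

variable [Fintype I] [Fintype O] {K : Type*} [Field K] {N R : ℕ}

theorem vecMul_adjMatrix_inl (c : ADTCode I O K N R) (y : I ⊕ O → K) (e' : I) :
    (y ᵥ* G.adjMatrix c) (Sum.inl e') = ∑ e, if G.edge e e' then y (Sum.inr e) else 0 := by
  simp [vecMul, dotProduct, adjMatrix]

theorem vecMul_adjMatrix_inr (c : ADTCode I O K N R) (y : I ⊕ O → K) (e : O) :
    (y ᵥ* G.adjMatrix c) (Sum.inr e) =
      ∑ e', if G.inNode e' = G.outNode e then c.β e' e * y (Sum.inl e') else 0 := by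
  simp [vecMul, dotProduct, adjMatrix, mul_comm]

theorem Acyclic.det_one_sub_adjMatrix_ne_zero (hG : G.Acyclic) (c : ADTCode I O K N R) :
    (1 - G.adjMatrix c).det ≠ 0 := by
  refine fun hdet => ?_
  obtain ⟨y, hy_ne, hy⟩ := exists_vecMul_eq_zero_iff.2 hdet
  rw [vecMul_sub, vecMul_one, sub_eq_zero] at hy
  have hout : ∀ e, (∀ e', G.inNode e' = G.outNode e → y (Sum.inl e') = 0) → y (Sum.inr e) = 0 := by
    intro e he
    rw [hy, vecMul_adjMatrix_inr]
    refine Finset.sum_eq_zero fun e' _ => ?_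
    split_ifs with he'
    · rw [he e' he', mul_zero]
    · rfl
  have hin : ∀ v, ∀ e', G.inNode e' = v → y (Sum.inl e') = 0 := by
    intro v
    induction v using hG.wellFounded_adj.induction with
    | _ v ih =>
      rintro e' rfl
      rw [hy, vecMul_adjMatrix_inl]
      refine Finset.sum_eq_zero fun e _ => ?_
      split_ifs with hedge
      · exact hout e (ih _ ⟨e, e', rfl, rfl, hedge⟩)
      · rfl
  exact hy_ne (funext (Sum.rec (fun e' => hin _ e' rfl) fun e => hout e (hin _)))

variable {S : V} {T : Fin N → V}

theorem isTransmission_iff_vecMul_eq (c : ADTCode I O K N R) (x : Fin R → K) (y : I ⊕ O → K) :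
    G.IsTransmission S c x (y ∘ Sum.inl) (y ∘ Sum.inr) ↔
      y ᵥ* (1 - G.adjMatrix c) = x ᵥ* G.encMatrix S c := by
  rw [vecMul_sub, vecMul_one, sub_eq_iff_eq_add', funext_iff, Sum.forall]
  simp only [Pi.add_apply, vecMul_adjMatrix_inl, vecMul_adjMatrix_inr]
  refine and_congr (forall_congr' fun e' => ?_) (forall_congr' fun e => ?_)
  · simp [vecMul, dotProduct, encMatrix]
  · simp [vecMul, dotProduct, encMatrix, mul_comm]

theorem Acyclic.isTransmission_iff_eq_vecMul (hG : G.Acyclic) (c : ADTCode I O K N R)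
    (x : Fin R → K) (y : I ⊕ O → K) :
    G.IsTransmission S c x (y ∘ Sum.inl) (y ∘ Sum.inr) ↔
      y = x ᵥ* (G.encMatrix S c * (1 - G.adjMatrix c)⁻¹) := by
  have hunit : IsUnit (1 - G.adjMatrix c).det := (hG.det_one_sub_adjMatrix_ne_zero c).isUnit
  rw [isTransmission_iff_vecMul_eq]
  constructor
  · intro hy
    rw [← vecMul_vecMul, ← hy, vecMul_vecMul, mul_nonsing_inv _ hunit, vecMul_one]
  · rintro rfl
    rw [vecMul_vecMul, Matrix.mul_assoc, nonsing_inv_mul _ hunit, Matrix.mul_one]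

theorem decoded_eq_vecMul (c : ADTCode I O K N R) (y : I ⊕ O → K) (i : Fin N) :
    G.decoded T c (y ∘ Sum.inl) i = y ᵥ* (G.decMatrix T c i)ᵀ := by
  ext k
  simp [decoded, vecMul, dotProduct, decMatrix, mul_comm]

theorem Acyclic.solvable_iff_exists_forall_systemMatrix_eq_one (hG : G.Acyclic) :
    G.Solvable K S T R ↔ ∃ c : ADTCode I O K N R, ∀ i, G.systemMatrix S T c i = 1 := by
  refine exists_congr fun c => ?_
  have hdecoded : ∀ x yI yO, G.IsTransmission S c x yI yO → ∀ i,
      G.decoded T c yI i = x ᵥ* G.systemMatrix S T c i := fun x yI yO hy i => by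
    have hy_eq := (hG.isTransmission_iff_eq_vecMul c x (Sum.elim yI yO)).1 hy
    rw [← Sum.elim_comp_inl yI yO, decoded_eq_vecMul, hy_eq, vecMul_vecMul, systemMatrix]
  constructor
  · intro hc i
    refine ext_iff_vecMul.2 fun x => ?_
    obtain ⟨⟨yI, yO, hy⟩, hdecodes⟩ := hc x
    rw [← hdecoded x yI yO hy, hdecodes yI yO hy, vecMul_one]
  · intro hc x
    refine ⟨⟨_, _, (hG.isTransmission_iff_eq_vecMul c x _).2 rfl⟩, fun yI yO hy i => ?_⟩
    rw [hdecoded x yI yO hy, hc, vecMul_one]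

theorem Acyclic.solvable_iff_exists_forall_det_ne_zero (hG : G.Acyclic) :
    G.Solvable K S T R ↔ ∃ c : ADTCode I O K N R, ∀ i, (G.systemMatrix S T c i).det ≠ 0 := by
  rw [hG.solvable_iff_exists_forall_systemMatrix_eq_one]
  constructor
  · exact Exists.imp fun c hc i => by rw [hc, det_one]; exact one_ne_zero
  rintro ⟨c, hc⟩
  let c' : ADTCode I O K N R :=
    { c with ε := fun e' i k => ∑ l, c.ε e' i l * (G.systemMatrix S T c i)⁻¹ l k }
  have hdec : ∀ i, (G.decMatrix T c' i)ᵀ = (G.decMatrix T c i)ᵀ * (G.systemMatrix S T c i)⁻¹ := by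
    intro i
    ext (e' | e) k
    · by_cases he : G.inNode e' = T i <;> simp [decMatrix, mul_apply, c', he]
    · simp [decMatrix, mul_apply]
  refine ⟨c', fun i => ?_⟩
  calc G.systemMatrix S T c' i = G.systemMatrix S T c i * (G.systemMatrix S T c i)⁻¹ := by
        rw [systemMatrix, hdec, ← Matrix.mul_assoc]
        rfl
    _ = 1 := mul_nonsing_inv _ (hc i).isUnit

end Transmission

section TransferMatrix

open scoped Classical

variable {V I O : Type*} {G : ADTNetwork V I O} {K : Type*} [Field K] {N R : ℕ}

/-- The block matrix `[[0, A], [Bᵢᵀ, F - 1]]` of destination `i`. Every coding variable is a single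
entry of it, and the system matrix `A (1 - F)⁻¹ Bᵢᵀ` is its Schur complement. -/
noncomputable def transferMatrix (G : ADTNetwork V I O) (S : V) (T : Fin N → V)
    (c : ADTCode I O K N R) (i : Fin N) : Matrix (Fin R ⊕ (I ⊕ O)) (Fin R ⊕ (I ⊕ O)) K :=
  fromBlocks 0 (G.encMatrix S c) (G.decMatrix T c i)ᵀ (G.adjMatrix c - 1)

/-- The supernode at which a row or column of a transfer matrix sits. The `R` indices of the source
or decoded processes sit at `s`, which is the source for rows and the destination for columns. -/
def indexNode (G : ADTNetwork V I O) (R : ℕ) (s : V) : Fin R ⊕ (I ⊕ O) → V :=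
  Sum.elim (fun _ => s) (Sum.elim G.inNode G.outNode)

/-- The type of the coding variables: one `α k e`, one `β e' e` and one `ε e' i k` for every choice
of the indices. -/
abbrev CodingVar (I O : Type*) (N R : ℕ) : Type _ :=
  (Fin R × O) ⊕ (I × O) ⊕ (I × Fin N × Fin R)

/-- The code whose coding variables have the values `v`. -/
def codeOf (v : CodingVar I O N R → K) : ADTCode I O K N R where
  α k e := v (Sum.inl (k, e))
  β e' e := v (Sum.inr (Sum.inl (e', e)))
  ε e' i k := v (Sum.inr (Sum.inr (e', i, k)))

/-- The coding variable, if any, that stands at an entry of the transfer matrix of destination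
`i`. -/
noncomputable def codingVar (G : ADTNetwork V I O) (S : V) (T : Fin N → V) (i : Fin N) :
    Fin R ⊕ (I ⊕ O) → Fin R ⊕ (I ⊕ O) → Option (CodingVar I O N R)
  | Sum.inl k, Sum.inr (Sum.inr e) =>
    if G.outNode e = S then some (Sum.inl (k, e)) else none
  | Sum.inr (Sum.inl e'), Sum.inr (Sum.inr e) =>
    if G.inNode e' = G.outNode e then some (Sum.inr (Sum.inl (e', e))) else none
  | Sum.inr (Sum.inl e'), Sum.inl k =>
    if G.inNode e' = T i then some (Sum.inr (Sum.inr (e', i, k))) else none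
  | _, _ => none

variable {S : V} {T : Fin N → V}

theorem transferMatrix_codeOf (v : CodingVar I O N R → K) (i : Fin N) :
    G.transferMatrix S T (codeOf v) i =
      mixedMatrix (G.transferMatrix S T (codeOf 0) i) (G.codingVar S T i) v := by
  ext (k | e' | e) (l | f' | f) <;>
    simp only [transferMatrix, mixedMatrix, codingVar, codeOf, encMatrix, decMatrix, adjMatrix,
      fromBlocks_apply₁₁, fromBlocks_apply₁₂, fromBlocks_apply₂₁, fromBlocks_apply₂₂,
      transpose_apply, of_apply, Matrix.sub_apply, Matrix.zero_apply, Pi.zero_apply] <;> grind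

theorem subsingleton_setOf_mem_codingVar (i : Fin N) (s : CodingVar I O N R) :
    {p : (Fin R ⊕ (I ⊕ O)) × (Fin R ⊕ (I ⊕ O)) |
      s ∈ G.codingVar S T i p.1 p.2}.Subsingleton := by
  let entry : CodingVar I O N R → (Fin R ⊕ (I ⊕ O)) × (Fin R ⊕ (I ⊕ O)) :=
    Sum.elim (fun a => (Sum.inl a.1, Sum.inr (Sum.inr a.2)))
      (Sum.elim (fun b => (Sum.inr (Sum.inl b.1), Sum.inr (Sum.inr b.2)))
        fun d => (Sum.inr (Sum.inl d.1), Sum.inl d.2.2))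
  have hentry : ∀ p q, s ∈ G.codingVar S T i p q → (p, q) = entry s := by
    rintro (k | e' | e) (l | f' | f) <;> simp only [codingVar] <;> grind
  intro p hp q hq
  exact (hentry _ _ hp).trans (hentry _ _ hq).symm

theorem codingVar_ne_none {i : Fin N} (hST : T i ≠ S) {p q : Fin R ⊕ (I ⊕ O)}
    (hp : ∀ e, p ≠ Sum.inr (Sum.inr e)) (hq : ∀ e', q ≠ Sum.inr (Sum.inl e'))
    (hpq : G.indexNode R S p = G.indexNode R (T i) q) : G.codingVar S T i p q ≠ none := by
  rcases p with k | e' | e <;> rcases q with l | f' | f <;>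
    simp only [codingVar, indexNode, Sum.elim_inl, Sum.elim_inr] at * <;> grind

theorem transferMatrix_codeOf_zero_inl (i : Fin N) (e' : I) (q : Fin R ⊕ (I ⊕ O)) :
    G.transferMatrix S T (codeOf (0 : CodingVar I O N R → K)) i (Sum.inr (Sum.inl e')) q =
      if q = Sum.inr (Sum.inl e') then -1 else 0 := by
  rcases q with l | f' | f <;>
    simp [transferMatrix, codeOf, decMatrix, adjMatrix, one_apply, eq_comm, neg_ite]

theorem transferMatrix_codeOf_zero_inr (i : Fin N) (p : Fin R ⊕ (I ⊕ O)) (e : O) :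
    G.transferMatrix S T (codeOf (0 : CodingVar I O N R → K)) i p (Sum.inr (Sum.inr e)) =
      if p = Sum.inr (Sum.inr e) then -1 else 0 := by
  rcases p with k | f' | f <;>
    simp [transferMatrix, codeOf, encMatrix, adjMatrix, one_apply, neg_ite]

theorem single_mem_span_row_eraseLines (i : Fin N) {C D : Finset (Fin R ⊕ (I ⊕ O))} {e' : I}
    (hC : Sum.inr (Sum.inl e') ∉ C) (hD : Sum.inr (Sum.inl e') ∉ D) :
    Pi.single (Sum.inr (Sum.inl e')) 1 ∈ Submodule.span K (Set.range
      (eraseLines C D (G.transferMatrix S T (codeOf (0 : CodingVar I O N R → K)) i)).row) := by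
  rw [← Submodule.neg_mem_iff]
  refine Submodule.subset_span ⟨Sum.inr (Sum.inl e'), funext fun q => ?_⟩
  simp only [row, eraseLines_apply, transferMatrix_codeOf_zero_inl, Pi.neg_apply, Pi.single_apply]
  grind

theorem single_mem_span_col_eraseLines (i : Fin N) {C D : Finset (Fin R ⊕ (I ⊕ O))} {e : O}
    (hC : Sum.inr (Sum.inr e) ∉ C) (hD : Sum.inr (Sum.inr e) ∉ D) :
    Pi.single (Sum.inr (Sum.inr e)) 1 ∈ Submodule.span K (Set.range
      (eraseLines C D (G.transferMatrix S T (codeOf (0 : CodingVar I O N R → K)) i)).col) := by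
  rw [← Submodule.neg_mem_iff]
  refine Submodule.subset_span ⟨Sum.inr (Sum.inr e), funext fun p => ?_⟩
  simp only [col, transpose_apply, eraseLines_apply, transferMatrix_codeOf_zero_inr, Pi.neg_apply,
    Pi.single_apply]
  grind

variable [Fintype I] [Fintype O]

theorem Acyclic.det_systemMatrix_ne_zero_iff (hG : G.Acyclic) (c : ADTCode I O K N R) (i : Fin N) :
    (G.systemMatrix S T c i).det ≠ 0 ↔ (G.transferMatrix S T c i).det ≠ 0 := by
  have hdet := hG.det_one_sub_adjMatrix_ne_zero c
  let _ := invertibleOfIsUnitDet _ hdet.isUnit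
  let _ := invertibleNeg (1 - G.adjMatrix c)
  have hschur : (G.transferMatrix S T c i).det =
      (-(1 - G.adjMatrix c)).det * (G.systemMatrix S T c i).det := by
    rw [transferMatrix, ← neg_sub, det_fromBlocks₂₂, invOf_neg, invOf_eq_nonsing_inv, systemMatrix,
      zero_sub, Matrix.mul_neg, Matrix.neg_mul, neg_neg]
  rw [hschur, mul_ne_zero_iff, det_neg, and_iff_right]
  exact mul_ne_zero (pow_ne_zero _ (neg_ne_zero.2 one_ne_zero)) hdet

/-- The rows of a transfer matrix that sit outside `Ω`. -/
noncomputable def cutRows (G : ADTNetwork V I O) (R : ℕ) (s : V) (Ω : Set V) :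
    Finset (Fin R ⊕ (I ⊕ O)) :=
  {p | G.indexNode R s p ∉ Ω}

/-- The columns of a transfer matrix that sit in `Ω`. -/
noncomputable def cutCols (G : ADTNetwork V I O) (R : ℕ) (t : V) (Ω : Set V) :
    Finset (Fin R ⊕ (I ⊕ O)) :=
  {q | G.indexNode R t q ∈ Ω}

theorem mem_cutRows {s : V} {Ω : Set V} {p : Fin R ⊕ (I ⊕ O)} :
    p ∈ G.cutRows R s Ω ↔ G.indexNode R s p ∉ Ω := by
  simp only [cutRows, Finset.mem_filter_univ]

theorem mem_cutCols {t : V} {Ω : Set V} {q : Fin R ⊕ (I ⊕ O)} :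
    q ∈ G.cutCols R t Ω ↔ G.indexNode R t q ∈ Ω := by
  simp only [cutCols, Finset.mem_filter_univ]

theorem card_cutCols (t : V) (Ω : Set V) :
    (G.cutCols R t Ω).card = (if t ∈ Ω then R else 0) +
      (Finset.univ.filter fun p : I ⊕ O => Sum.elim G.inNode G.outNode p ∈ Ω).card := by
  have hdisjSum : G.cutCols R t Ω = (if t ∈ Ω then Finset.univ else ∅ : Finset (Fin R)).disjSum
      (Finset.univ.filter fun p : I ⊕ O => Sum.elim G.inNode G.outNode p ∈ Ω) := by
    ext (k | p)
    · by_cases ht : t ∈ Ω <;> simp [mem_cutCols, indexNode, ht]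
    · simp [mem_cutCols, indexNode]
  rw [hdisjSum, Finset.card_disjSum, apply_ite Finset.card, Finset.card_univ, Fintype.card_fin,
    Finset.card_empty]

theorem card_cutRows_add_card_cutCols (s t : V) (Ω : Set V) :
    (G.cutRows R s Ω).card + (G.cutCols R t Ω).card =
      (if s ∈ Ω then 0 else R) + (if t ∈ Ω then R else 0) + Fintype.card (I ⊕ O) := by
  have hcompl : (G.cutCols R s Ω).card + (G.cutRows R s Ω).card = R + Fintype.card (I ⊕ O) := by
    rw [cutCols, cutRows, Finset.card_filter_add_card_filter_not, Finset.card_univ,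
      Fintype.card_sum, Fintype.card_fin]
  have hs := G.card_cutCols (R := R) s Ω
  have ht := G.card_cutCols (R := R) t Ω
  split_ifs at * <;> lia

/-- Apart from the edges, a nonzero entry of the transfer matrix joins two indices that sit at the
same supernode. -/
theorem rank_eraseLines_transferMatrix (c : ADTCode I O K N R) {i : Fin N} {Ω : Set V}
    (hΩ : IsCut S (T i) Ω) :
    (eraseLines (G.cutRows R S Ω) (G.cutCols R (T i) Ω) (G.transferMatrix S T c i)).rank =
      (G.cutMatrix K Ω).rank := by
  rw [← rank_submatrix_eq_of_support (f := fun e : {e // G.outNode e ∈ Ω} => Sum.inr (Sum.inr e.1))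
    (g := fun e' : {e' // G.inNode e' ∉ Ω} => Sum.inr (Sum.inl e'.1))]
  · congr 1
    ext e e'
    simp [eraseLines_apply, mem_cutRows, mem_cutCols, indexNode, e.2, e'.2, transferMatrix,
      adjMatrix, cutMatrix]
  · obtain ⟨hS, hT⟩ := hΩ
    rintro (k | e' | e) (l | f' | f) <;>
      simp only [eraseLines_apply, mem_cutRows, mem_cutCols, indexNode, transferMatrix, adjMatrix,
        encMatrix, decMatrix, one_apply, fromBlocks_apply₁₁, fromBlocks_apply₁₂,
        fromBlocks_apply₂₁, fromBlocks_apply₂₂, transpose_apply, of_apply, Matrix.sub_apply,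
        Matrix.zero_apply, Sum.elim_inl, Sum.elim_inr, Set.mem_range, Subtype.exists] <;> grind

theorem Acyclic.le_mincut_of_solvable (hG : G.Acyclic) (hST : ∀ i, T i ≠ S)
    (hsolv : G.Solvable K S T R) (i : Fin N) : R ≤ G.mincut K S (T i) := by
  obtain ⟨c, hc⟩ := hG.solvable_iff_exists_forall_det_ne_zero.1 hsolv
  have hrank := det_ne_zero_iff_card_le_rank.1 ((hG.det_systemMatrix_ne_zero_iff c i).1 (hc i))
  refine (G.le_mincut_iff K (hST i)).2 fun Ω hΩ => ?_
  have hcover := card_add_card_add_rank_eraseLines_le_of_subset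
    (Finset.empty_subset (G.cutRows R S Ω)) (Finset.empty_subset (G.cutCols R (T i) Ω))
    (G.transferMatrix S T c i)
  have hcard := G.card_cutRows_add_card_cutCols (R := R) S (T i) Ω
  rw [if_pos hΩ.1, if_neg hΩ.2] at hcard
  rw [eraseLines_empty, rank_eraseLines_transferMatrix c hΩ] at hcover
  rw [Fintype.card_sum, Fintype.card_fin] at hrank
  simp only [Finset.card_empty] at hcover
  lia

theorem card_cutRows_add_card_cutCols_add_rank_le {C D : Finset (Fin R ⊕ (I ⊕ O))} {Ω : Set V}
    (i : Fin N) (hC : ∀ p ∉ C, G.indexNode R S p ∉ Ω → ∃ e, p = Sum.inr (Sum.inr e))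
    (hD : ∀ q ∉ D, G.indexNode R (T i) q ∈ Ω → ∃ e', q = Sum.inr (Sum.inl e')) :
    (G.cutRows R S Ω).card + (G.cutCols R (T i) Ω).card +
        (eraseLines (G.cutRows R S Ω) (G.cutCols R (T i) Ω)
          (G.transferMatrix S T (codeOf (0 : CodingVar I O N R → K)) i)).rank ≤
      C.card + D.card +
        (eraseLines C D (G.transferMatrix S T (codeOf (0 : CodingVar I O N R → K)) i)).rank := by
  set Q := G.transferMatrix S T (codeOf (0 : CodingVar I O N R → K)) i
  set C₁ := G.cutRows R S Ω
  set D₁ := G.cutCols R (T i) Ω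
  have hcols : (D₁ \ D).card + (eraseLines ∅ (D₁ \ D) (eraseLines (C₁ ∩ C) (D₁ ∩ D) Q)).rank ≤
      (eraseLines (C₁ ∩ C) (D₁ ∩ D) Q).rank := by
    refine card_add_rank_eraseLines_cols_le fun q hq => ?_
    obtain ⟨hq₁, hqD⟩ := Finset.mem_sdiff.1 hq
    obtain ⟨e', rfl⟩ := hD q hqD (mem_cutCols.1 hq₁)
    refine single_mem_span_row_eraseLines i (fun he => ?_) fun he => hqD (Finset.mem_inter.1 he).2
    exact mem_cutRows.1 (Finset.mem_inter.1 he).1 ((mem_cutCols (t := T i)).1 hq₁)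
  have hrows : (C₁ \ C).card + (eraseLines (C₁ \ C) ∅ (eraseLines (C₁ ∩ C) D₁ Q)).rank ≤
      (eraseLines (C₁ ∩ C) D₁ Q).rank := by
    refine card_add_rank_eraseLines_rows_le fun p hp => ?_
    obtain ⟨hp₁, hpC⟩ := Finset.mem_sdiff.1 hp
    obtain ⟨e, rfl⟩ := hC p hpC (mem_cutRows.1 hp₁)
    refine single_mem_span_col_eraseLines i (fun he => hpC (Finset.mem_inter.1 he).2) fun he => ?_
    exact mem_cutRows.1 hp₁ ((mem_cutCols (t := T i)).1 he)
  rw [eraseLines_eraseLines, Finset.empty_union, Finset.sdiff_union_inter] at hcols hrows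
  have hshrink := card_add_card_add_rank_eraseLines_le_of_subset
    (Finset.inter_subset_right (s₁ := C₁) (s₂ := C))
    (Finset.inter_subset_right (s₁ := D₁) (s₂ := D)) Q
  have hC₁ := Finset.card_sdiff_add_card_inter C₁ C
  have hD₁ := Finset.card_sdiff_add_card_inter D₁ D
  lia

theorem card_le_of_codingVar_cover {i : Fin N} (hST : T i ≠ S) (hcut : R ≤ G.mincut K S (T i))
    {C D : Finset (Fin R ⊕ (I ⊕ O))}
    (hcover : ∀ p q, G.codingVar S T i p q ≠ none → p ∈ C ∨ q ∈ D) :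
    Fintype.card (Fin R ⊕ (I ⊕ O)) ≤
      C.card + D.card +
        (eraseLines C D (G.transferMatrix S T (codeOf (0 : CodingVar I O N R → K)) i)).rank := by
  let Ω := {v | ∃ p ∉ C, (∀ e, p ≠ Sum.inr (Sum.inr e)) ∧ G.indexNode R S p = v}
  have hle := card_cutRows_add_card_cutCols_add_rank_le (K := K) (C := C) (D := D) (Ω := Ω) i
    (fun p hp hpΩ => by_contra fun hout => hpΩ ⟨p, hp, not_exists.1 hout, rfl⟩)
    (by
      rintro q hq ⟨p, hp, hout, hpq⟩
      by_contra hin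
      exact (hcover p q (codingVar_ne_none hST hout (not_exists.1 hin) hpq)).elim hp hq)
  refine le_trans ?_ hle
  rw [card_cutRows_add_card_cutCols, Fintype.card_sum, Fintype.card_fin]
  by_cases hΩ : IsCut S (T i) Ω
  · rw [rank_eraseLines_transferMatrix _ hΩ, if_pos hΩ.1, if_neg hΩ.2]
    have hrank := (G.le_mincut_iff K hST).1 hcut Ω hΩ
    lia
  · rw [IsCut, not_and_or, not_not] at hΩ
    rcases hΩ with hS | hT
    · rw [if_neg hS]
      lia
    · rw [if_pos hT]
      lia

theorem Acyclic.exists_forall_det_systemMatrix_ne_zero (hG : G.Acyclic) (hST : ∀ i, T i ≠ S)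
    (hN : (N : ℕ∞) < ENat.card K) (hcut : ∀ i, R ≤ G.mincut K S (T i)) :
    ∃ c : ADTCode I O K N R, ∀ i, (G.systemMatrix S T c i).det ≠ 0 := by
  obtain ⟨A, hA⟩ := exists_finset_card_eq_of_le_card (n := N + 1) (Order.add_one_le_of_lt hN)
  obtain ⟨v, -, hv⟩ := exists_forall_det_mixedMatrix_ne_zero
    (A := A) (by rw [hA, Fintype.card_fin]; exact N.lt_succ_self)
    (fun i => subsingleton_setOf_mem_codingVar (G := G) (R := R) (S := S) (T := T) i)
    fun i C D hcover => card_le_of_codingVar_cover (K := K) (hST i) (hcut i) hcover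
  refine ⟨codeOf v, fun i => (hG.det_systemMatrix_ne_zero_iff _ i).2 ?_⟩
  rw [transferMatrix_codeOf]
  exact hv i

end TransferMatrix

end ADTNetwork

theorem mainTheorem3_general {V I O : Type*} [Fintype I] [Fintype O] (G : ADTNetwork V I O)
    (hG : G.Acyclic) {F : Type u} [Field F] {N : ℕ} (S : V) (T : Fin N → V) (hST : ∀ i, T i ≠ S)
    (R : ℕ) :
    ((∃ (K : Type u) (_ : Field K) (_ : Algebra F K), FiniteDimensional F K ∧
          G.Solvable K S T R) ↔
        ∀ i, R ≤ G.mincut F S (T i)) ∧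
    (G.Solvable F S T R → ∀ i, R ≤ G.mincut F S (T i)) ∧
    ((N : ℕ∞) < ENat.card F →
      (G.Solvable F S T R ↔ ∀ i, R ≤ G.mincut F S (T i)) ∧
      ((∀ i, R ≤ G.mincut F S (T i)) →
        ∃ c : ADTCode I O F N R, ∀ i, (G.systemMatrix S T c i).det ≠ 0)) := by
  have hnec : ∀ {K : Type u} [Field K], G.Solvable K S T R → ∀ i, R ≤ G.mincut K S (T i) :=
    hG.le_mincut_of_solvable hST
  have hcode : ∀ {K : Type u} [Field K], (N : ℕ∞) < ENat.card K →
      (∀ i, R ≤ G.mincut K S (T i)) →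
        ∃ c : ADTCode I O K N R, ∀ i, (G.systemMatrix S T c i).det ≠ 0 :=
    hG.exists_forall_det_systemMatrix_ne_zero hST
  have hsuff : ∀ {K : Type u} [Field K], (N : ℕ∞) < ENat.card K →
      (∀ i, R ≤ G.mincut K S (T i)) → G.Solvable K S T R :=
    fun hN hcut => hG.solvable_iff_exists_forall_det_ne_zero.2 (hcode hN hcut)
  refine ⟨⟨?_, fun hcut => ?_⟩, hnec, fun hN => ⟨⟨hnec, hsuff hN⟩, hcode hN⟩⟩
  · rintro ⟨K, _, _, -, hsolv⟩
    simpa only [G.mincut_algebraMap F K] using hnec hsolv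
  · obtain ⟨K, _, _, hfin, hN⟩ := exists_finiteDimensional_extension_lt_card F N
    refine ⟨K, _, _, hfin, hsuff hN ?_⟩
    simpa only [G.mincut_algebraMap F K] using hcut

theorem mainTheorem3 {V I O : Type*} [Fintype V] [Fintype I] [Fintype O]
    (G : ADTNetwork V I O) (hG : G.Acyclic)
    {F : Type u} [Field F] [Fintype F]
    {N : ℕ} (S : V) (T : Fin N → V) (hST : ∀ i, T i ≠ S) (R : ℕ) :
    ((∃ (K : Type u) (_ : Field K) (_ : Fintype K) (_ : Algebra F K), G.Solvable K S T R) ↔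
        ∀ i, R ≤ G.mincut F S (T i)) ∧
    (G.Solvable F S T R → ∀ i, R ≤ G.mincut F S (T i)) ∧
    (N < Fintype.card F →
      (G.Solvable F S T R ↔ ∀ i, R ≤ G.mincut F S (T i)) ∧
      ((∀ i, R ≤ G.mincut F S (T i)) →
        ∃ c : ADTCode I O F N R, ∀ i, (G.systemMatrix S T c i).det ≠ 0)) := by
  obtain ⟨hext, hnec, hsuff⟩ := mainTheorem3_general G hG (F := F) S T hST R
  exact ⟨(exists_fintype_extension_iff fun K _ => G.Solvable K S T R).trans hext, hnec,
    fun hN => hsuff (by rwa [ENat.card_eq_coe_fintype_card, Nat.cast_lt])⟩
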